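/- Let $\Gamma$ be a countably infinite group with identity $\mathbf 1$. For $k \in \mathbb{N}$, identify $k$ with the discrete space $\{0,\dots,k-1\}$, give $k^\Gamma$ the product topology, and let $\Gamma$ act on $k^\Gamma$ by the shift $(\gamma\cdot x)(\delta) = x(\delta\gamma)$. Let $\mathsf{Free}(k^\Gamma)$ be the set of points of $k^\Gamma$ with trivial stabilizer. A subshift is a closed shift-invariant subset of $k^\Gamma$. Given an action of $\Gamma$ on $X$ and a finite set $S \subset \Gamma$, the action is $S$-free if no non-identity element of $S$ fixes a point of $X$; a set $A \subseteq X$ is $S$-syndetic if $S^{-1}\cdot A = X$. For $f \colon X \to k$, the coding map $\pi_f \colon X \to k^\Gamma$ is given by $\pi_f(x)(\gamma) = f(\gamma\cdot x)$. An action on a topological space is continuous if every element of $\Gamma$ acts by a homeomorphism, and a space is zero-dimensional if it has a base of clopen sets. **Lemma.** Fix integers $k \ge 2$ and $m \ge 1$ and let $\rho \colon \mathsf{Free}(k^\Gamma) \to m$ be continuous. Given finite sets $D, T \subset \Gamma$, there exist a subshift $\mathcal{Z} \subseteq k^\Gamma$, a continuous map $\tilde\rho \colon \mathcal{Z} \to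 m$, and a finite set $S \subset \Gamma$ with the following properties. (I) For each $z \in \mathcal{Z}$ there is $z^\ast \in \mathsf{Free}(k^\Gamma)$ such that (a) $z(\delta) = z^\ast(\delta)$ for all $\delta \in D$, and (b) $\tilde\rho(\delta\cdot z) = \rho(\delta\cdot z^\ast)$ for all $\delta \in D$. (II) Let $\Gamma$ act continuously and $S$-freely on a zero-dimensional Polish space $X$, and let $C_0 \subseteq X$ be a clopen set whose complement $X \setminus C_0$ is $T$-syndetic. Then every continuous map $f_0 \colon C_0 \to k$ extends to a continuous map $f \colon X \to k$ with $\pi_f(X) \subseteq \mathcal{Z}$. -/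

import Mathlib

namespace BernoulliShift

variable {G : Type*} [Group G]

/-- The Bernoulli shift action of `G` on `k^G`: `(γ · x)(δ) = x(δγ)`. -/
def shift {k : ℕ} (γ : G) (x : G → Fin k) : G → Fin k := fun δ => x (δ * γ)

theorem shift_one {k : ℕ} (x : G → Fin k) : shift (1 : G) x = x := by
  funext δ
  simp [shift]

theorem shift_mul {k : ℕ} (γ δ : G) (x : G → Fin k) :
    shift (γ * δ) x = shift γ (shift δ x) := by
  funext σ
  simp [shift, mul_assoc]

/-- The stabilizer of a point of `k^G` under the shift action. -/
def stab {k : ℕ} (x : G → Fin k) : Set G := {γ | shift γ x = x}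

/-- The free part of `k^G`: the points with trivial stabilizer. -/
def freePart (G : Type*) [Group G] (k : ℕ) : Set (G → Fin k) := {x | stab x = {1}}

theorem shift_mem_freePart {k : ℕ} (γ : G) {x : G → Fin k} (hx : x ∈ freePart G k) :
    shift γ x ∈ freePart G k := by
  have hx' : stab x = {1} := hx
  change stab (shift γ x) = {1}
  ext σ
  constructor
  · intro hσ
    have h1 : shift σ (shift γ x) = shift γ x := hσ
    have h2 : γ⁻¹ * σ * γ ∈ stab x := by
      change shift (γ⁻¹ * σ * γ) x = x
      rw [shift_mul, shift_mul, h1, ← shift_mul, inv_mul_cancel, shift_one]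
    rw [hx', Set.mem_singleton_iff] at h2
    have h3 : σ = γ * (γ⁻¹ * σ * γ) * γ⁻¹ := by group
    rw [Set.mem_singleton_iff, h3, h2]
    simp
  · rintro rfl
    exact shift_one _

/-- The shift action restricted to the free part of `k^G`. -/
def freeShift {k : ℕ} (γ : G) (x : freePart G k) : freePart G k :=
  ⟨shift γ x.1, shift_mem_freePart γ x.2⟩

/-- A subshift of `k^G`: a closed shift-invariant subset, where `k^G` carries the product of the
discrete topologies. -/
structure Subshift (G : Type*) [Group G] (k : ℕ) where
  carrier : Set (G → Fin k)
  isClosed : IsClosed carrier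
  shift_mem : ∀ (γ : G) (x : G → Fin k), x ∈ carrier → shift γ x ∈ carrier

/-- The shift action restricted to a subshift. -/
def Subshift.act {k : ℕ} (Z : Subshift G k) (γ : G) (z : Z.carrier) : Z.carrier :=
  ⟨shift γ z.1, Z.shift_mem γ z.1 z.2⟩

/-- The coding map `π_f : X → k^G` of a function `f : X → k`: `π_f(x)(γ) = f(γ · x)`. -/
def codingMap {X : Type*} [MulAction G X] {k : ℕ} (f : X → Fin k) (x : X) : G → Fin k :=
  fun γ => f (γ • x)

/-- The action of `G` on `X` is `F`-free: `F ∩ Stab(x) ⊆ {1}` for all `x`. -/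
def IsFreeOn (F : Finset G) (X : Type*) [MulAction G X] : Prop :=
  ∀ x : X, (F : Set G) ∩ (MulAction.stabilizer G x : Set G) ⊆ {1}

open scoped Pointwise in
/-- A set `A ⊆ X` is `S`-syndetic: `S⁻¹ · A = X`. -/
def IsSyndetic {X : Type*} [MulAction G X] (S : Finset G) (A : Set X) : Prop :=
  (S : Set G)⁻¹ • A = Set.univ

/-- A topological space is zero-dimensional: it has a base consisting of clopen sets. -/
def IsZeroDimensional (X : Type*) [TopologicalSpace X] : Prop :=
  TopologicalSpace.IsTopologicalBasis {s : Set X | IsClopen s}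

end BernoulliShift

/-! Enumerate the group as `e 0, e 1, …`. The subshift `distinguishing k e F n` asks that every
translate of a point differ from its image under `e i` inside a finite window `F i`, for all `i <
n`. These subshifts decrease to a compact invariant set `Y` of free points. Since `k^Γ` is
profinite, `ρ` restricted to `Y` extends to a locally constant map on all of `k^Γ`. By compactness,
for some `n` every point of the `n`-th subshift looks, on `D` and in the values of this map along
`D`, like a point of `Y` (`exists_approximation`). This is (I).

For (II), `exists_extension_step` treats one element `γ`. Its windows depend only on `γ` and `T`,
never on `X`, and an uncoloured syndetic set survives, so the step can be iterated. In one step,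
clopen separated markers are chosen. Each has at least `4N+1` uncoloured slots in its
`Q`-neighbourhood besides one reserved slot that stays uncoloured, and the slots are painted with a
pattern. A pattern is bad if it agrees in at least `N` slots with old colours, with its own
translate, or with the pattern of a nearby marker. One such coincidence excludes at most `k ^ (|Q| -
N)` of the `k ^ |Q|` patterns, and the number of coincidences to avoid is polynomial in `N`. Hence a
maximal conflict-free labelling gives every marker a pattern (`exists_isLocallyConstant_pattern`).
It can be taken clopen by a greedy construction (`exists_isClopen_maximal_independent`). A
pigeonhole over the slots (`exists_differing_slot`) then distinguishes `x` from `γ • x` near a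
marker. -/

open Topology

namespace BernoulliShift

/-! ### Clopen choices and maximal independent sets -/

section Topological

variable {X : Type*} [TopologicalSpace X]

theorem isLocallyConstant_of_eventually {α : Type*} {f : X → α}
    (h : ∀ x, ∀ᶠ y in 𝓝 x, f y = f x) : IsLocallyConstant f :=
  (IsLocallyConstant.iff_eventually_eq f).2 h

theorem _root_.IsLocallyConstant.setOf_isClopen {P : X → Prop} (h : IsLocallyConstant P) :
    IsClopen {x | P x} := by
  have := h.isClopen_fiber True
  simpa using this

theorem isLocallyConstant_of_isClopen {P : X → Prop} (h : IsClopen {x | P x}) :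
    IsLocallyConstant P := by
  refine isLocallyConstant_of_eventually fun x => ?_
  by_cases hx : P x
  · filter_upwards [h.isOpen.mem_nhds hx] with y hy
    exact propext ⟨fun _ => hx, fun _ => hy⟩
  · filter_upwards [h.compl.isOpen.mem_nhds (show x ∈ {x | P x}ᶜ from hx)] with y hy
    exact propext ⟨fun h' => absurd h' hy, fun h' => absurd h' hx⟩

/-- A finite family of clopen predicates, one of which holds at every point, admits a locally
constant choice. -/
theorem exists_isLocallyConstant_choice {A : Type*} [Finite A] (P : A → X → Prop)
    (hP : ∀ a, IsLocallyConstant (P a)) (h : ∀ x, ∃ a, P a x) :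
    ∃ c : X → A, IsLocallyConstant c ∧ ∀ x, P (c x) x := by
  classical
  rcases isEmpty_or_nonempty X with hX | ⟨⟨x₀⟩⟩
  · exact ⟨fun x => (hX.false x).elim, isLocallyConstant_of_eventually fun x => (hX.false x).elim,
      fun x => (hX.false x).elim⟩
  obtain ⟨a₀, -⟩ := h x₀
  -- `pick` sees only the set of admissible labels, which is locally constant in `x` because `A` is
  -- finite.
  let pick : (A → Prop) → A := fun q => if hq : ∃ a, q a then hq.choose else a₀
  refine ⟨fun x => pick fun a => P a x, isLocallyConstant_of_eventually fun x => ?_, fun x => ?_⟩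
  · have : ∀ᶠ y in 𝓝 x, ∀ a, P a y = P a x :=
      Filter.eventually_all.2 fun a => (hP a).eventually_eq x
    filter_upwards [this] with y hy
    simp only [hy]
  · have hx := h x
    simp only [pick, dif_pos hx]
    exact hx.choose_spec

/-- In a graph on `Y` in which taking neighbourhoods of sets preserves open and clopen sets,
every clopen set covered by countably many clopen independent subsets has a clopen maximal
independent subset. -/
theorem exists_isClopen_maximal_independent {Y : Type*} [TopologicalSpace Y]
    (r : Y → Y → Prop) (hsymm : ∀ a b, r a b → r b a) (V : Set Y) (hV : IsClosed V)
    (hopen : ∀ A : Set Y, IsOpen A → IsOpen {y | ∃ a ∈ A, r a y})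
    (hclosed : ∀ A : Set Y, IsClopen A → IsClosed {y | ∃ a ∈ A, r a y})
    (U : ℕ → Set Y) (hU : ∀ n, IsClopen (U n)) (hind : ∀ n, ∀ a ∈ U n, ∀ b ∈ U n, ¬ r a b)
    (hcov : ⋃ n, U n = V) :
    ∃ A : Set Y, IsClopen A ∧ A ⊆ V ∧ (∀ a ∈ A, ∀ b ∈ A, ¬ r a b) ∧
      ∀ y ∈ V, y ∉ A → ∃ a ∈ A, r a y := by
  let N : Set Y → Set Y := fun A => {y | ∃ a ∈ A, r a y}
  -- Greedy construction: add the part of `U n` that is not adjacent to what has been chosen.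
  let B : ℕ → Set Y := fun n => Nat.rec ∅ (fun n A => A ∪ (U n \ N A)) n
  have hBs : ∀ n, B (n + 1) = B n ∪ (U n \ N (B n)) := fun n => rfl
  have hBc : ∀ n, IsClopen (B n) := by
    intro n
    induction n with
    | zero => exact isClopen_empty
    | succ n ih =>
      rw [hBs]
      exact ih.union ((hU n).diff ⟨hclosed _ ih, hopen _ ih.isOpen⟩)
  have hBm : Monotone B := monotone_nat_of_le_succ fun n => by
    rw [hBs]; exact Set.subset_union_left
  have hBi : ∀ n, ∀ a ∈ B n, ∀ b ∈ B n, ¬ r a b := by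
    intro n
    induction n with
    | zero => intro a ha; exact absurd ha (Set.notMem_empty a)
    | succ n ih =>
      rw [hBs]
      rintro a (ha | ha) b (hb | hb) hab
      · exact ih a ha b hb hab
      · exact hb.2 ⟨a, ha, hab⟩
      · exact ha.2 ⟨b, hb, hsymm _ _ hab⟩
      · exact hind n a ha.1 b hb.1 hab
  have hBV : ∀ n, B n ⊆ V := by
    intro n
    induction n with
    | zero => exact Set.empty_subset _
    | succ n ih =>
      rw [hBs, ← hcov] at *
      exact Set.union_subset ih (Set.sdiff_subset.trans (Set.subset_iUnion U n))
  have hAi : ∀ a ∈ ⋃ n, B n, ∀ b ∈ ⋃ n, B n, ¬ r a b := by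
    intro a ha b hb
    obtain ⟨i, hi⟩ := Set.mem_iUnion.1 ha
    obtain ⟨j, hj⟩ := Set.mem_iUnion.1 hb
    exact hBi (max i j) a (hBm (le_max_left i j) hi) b (hBm (le_max_right i j) hj)
  have hmax : ∀ y ∈ V, y ∉ ⋃ n, B n → ∃ a ∈ ⋃ n, B n, r a y := by
    intro y hy hyA
    rw [← hcov] at hy
    obtain ⟨n, hn⟩ := Set.mem_iUnion.1 hy
    by_contra hcon
    refine hyA (Set.mem_iUnion.2 ⟨n + 1, ?_⟩)
    rw [hBs]
    refine Or.inr ⟨hn, ?_⟩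
    rintro ⟨a, ha, hay⟩
    exact hcon ⟨a, Set.mem_iUnion.2 ⟨n, ha⟩, hay⟩
  have hAo : IsOpen (⋃ n, B n) := isOpen_iUnion fun n => (hBc n).isOpen
  refine ⟨⋃ n, B n, ⟨⟨?_⟩, hAo⟩, Set.iUnion_subset hBV, hAi, hmax⟩
  -- An infinite union of clopen sets need not be closed. Here maximality and independence identify
  -- the complement with a neighbourhood set, which is open.
  have : (⋃ n, B n)ᶜ = Vᶜ ∪ N (⋃ n, B n) := by
    ext y
    constructor
    · intro hy
      by_cases hyV : y ∈ V
      · exact Or.inr (hmax y hyV hy)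
      · exact Or.inl hyV
    · rintro (hy | ⟨a, ha, hay⟩) hyA
      · exact hy (Set.iUnion_subset hBV hyA)
      · exact hAi a ha y hyA hay
  rw [this]
  exact hV.isOpen_compl.union (hopen _ hAo)

theorem isOpen_prod_of_fibers {P : Type*} [TopologicalSpace P] [DiscreteTopology P]
    {A : Set (X × P)} (h : ∀ p, IsOpen {x | (x, p) ∈ A}) : IsOpen A := by
  rw [isOpen_iff_mem_nhds]
  rintro ⟨x, p⟩ hx
  rw [nhds_prod_eq, nhds_discrete P, Filter.prod_pure]
  exact (h p).mem_nhds hx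

theorem isClopen_prod_of_fibers {P : Type*} [TopologicalSpace P] [DiscreteTopology P]
    {A : Set (X × P)} (h : ∀ p, IsClopen {x | (x, p) ∈ A}) : IsClopen A :=
  ⟨⟨isOpen_prod_of_fibers fun p => (h p).compl.isOpen⟩, isOpen_prod_of_fibers fun p => (h p).isOpen⟩

end Topological

/-! ### Conflict-free labellings for a group action -/

variable {G : Type*} [Group G] {X : Type*} [TopologicalSpace X] [MulAction G X]
  [ContinuousConstSMul G X]

theorem _root_.IsLocallyConstant.smul_left {α : Type*} {f : X → α} (hf : IsLocallyConstant f)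
    (g : G) : IsLocallyConstant fun x => f (g • x) :=
  hf.comp_continuous (continuous_const_smul g)

/-- Clopen selection: given a finite set `P` of labels and, for `h` in a finite set `H`, a locally
constant conflict relation between the labels of `x` and of `h • x`, there is a maximal conflict-free
locally constant set of labelled points. -/
theorem exists_maximal_conflictFree [T2Space X] [SecondCountableTopology X]
    (hX : IsZeroDimensional X) {P : Type*} [Finite P] (H : Finset G)
    (K : G → P → P → X → Prop) (hK : ∀ h p p', IsLocallyConstant (K h p p'))
    (hsymm : ∀ h ∈ H, ∀ p p' x, K h p p' x → h⁻¹ ∈ H ∧ K h⁻¹ p' p (h • x))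
    (hirr : ∀ h ∈ H, ∀ p x, K h p p x → h • x ≠ x)
    (V : P → X → Prop) (hV : ∀ p, IsLocallyConstant (V p)) :
    ∃ A : P → X → Prop, (∀ p, IsLocallyConstant (A p)) ∧ (∀ p x, A p x → V p x) ∧
      (∀ h ∈ H, ∀ p p' x, A p x → A p' (h • x) → ¬ K h p p' x) ∧
      ∀ p x, V p x → A p x ∨ ∃ h ∈ H, ∃ p', A p' (h • x) ∧ K h p p' x := by
  let : TopologicalSpace P := ⊥
  have : DiscreteTopology P := ⟨rfl⟩
  let r : X × P → X × P → Prop := fun a b => ∃ h ∈ H, b.1 = h • a.1 ∧ K h a.2 b.2 a.1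
  have hr : ∀ a b, r a b → r b a := by
    rintro ⟨x, p⟩ ⟨x', p'⟩ ⟨h, hh, hx, hk⟩
    dsimp only at hx hk
    subst hx
    obtain ⟨h1, h2⟩ := hsymm h hh p p' x hk
    exact ⟨h⁻¹, h1, by simp, h2⟩
  have hfib : ∀ (A : Set (X × P)) (p' : P),
      {x | (x, p') ∈ {y | ∃ a ∈ A, r a y}} =
        ⋃ h ∈ H, ⋃ p : P, {x | (h⁻¹ • x, p) ∈ A} ∩ {x | K h p p' (h⁻¹ • x)} := by
    intro A p'
    ext x
    simp only [Set.mem_ofPred_eq, Set.mem_iUnion, Set.mem_inter_iff, exists_prop, r]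
    constructor
    · rintro ⟨⟨x', p⟩, ha, h, hh, hx, hk⟩
      dsimp only at hx hk
      subst hx
      exact ⟨h, hh, p, by simpa using ha, by simpa using hk⟩
    · rintro ⟨h, hh, p, ha, hk⟩
      exact ⟨_, ha, h, hh, by simp, hk⟩
  have hslice : ∀ (h : G) (p : P), Continuous fun x : X => (h⁻¹ • x, p) := fun h p =>
    (continuous_const_smul _).prodMk continuous_const
  have hKc : ∀ h p p', IsClopen {x | K h p p' (h⁻¹ • x)} := fun h p p' =>
    ((hK h p p').smul_left h⁻¹).setOf_isClopen
  have hopen : ∀ A : Set (X × P), IsOpen A → IsOpen {y | ∃ a ∈ A, r a y} := by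
    intro A hA
    refine isOpen_prod_of_fibers fun p' => ?_
    rw [hfib]
    exact isOpen_biUnion fun h _ => isOpen_iUnion fun p =>
      (hA.preimage (hslice h p)).inter (hKc h p p').isOpen
  have hclosed : ∀ A : Set (X × P), IsClopen A → IsClosed {y | ∃ a ∈ A, r a y} := by
    intro A hA
    refine (isClopen_prod_of_fibers fun p' => ?_).isClosed
    rw [hfib]
    exact H.finite_toSet.isClopen_biUnion fun h _ => isClopen_iUnion_of_finite fun p =>
      (hA.preimage (hslice h p)).inter (hKc h p p')
  have hVc : IsClopen {y : X × P | V y.2 y.1} :=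
    isClopen_prod_of_fibers fun p => (hV p).setOf_isClopen
  have hnhd : ∀ y : X × P, ∃ O : Set (X × P), IsClopen O ∧ y ∈ O ∧ ∀ a ∈ O, ∀ b ∈ O, ¬ r a b := by
    rintro ⟨x, p⟩
    have h1 : ∀ h ∈ H, ∃ O : Set X, IsClopen O ∧ x ∈ O ∧ ∀ y ∈ O, h • y ∈ O → ¬ K h p p y := by
      intro h hh
      -- At a fixed point of `h`, equal labels do not conflict by `hirr`. Otherwise a small clopen
      -- neighbourhood is disjoint from its translate.
      by_cases hx : h • x = x
      · refine ⟨{y | ¬ K h p p y}, ?_, fun hk => hirr h hh p x hk hx, fun y hy _ => hy⟩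
        exact (hK h p p).setOf_isClopen.compl
      · obtain ⟨O₁, O₂, ho1, ho2, hx1, hx2, hd⟩ := t2_separation hx
        have hn : O₂ ∩ (fun y => h • y) ⁻¹' O₁ ∈ 𝓝 x :=
          Filter.inter_mem (ho2.mem_nhds hx2)
            ((ho1.preimage (continuous_const_smul h)).mem_nhds hx1)
        obtain ⟨O, hO, hxO, hsub⟩ := hX.mem_nhds_iff.1 hn
        refine ⟨O, hO, hxO, fun y hy hy' => ?_⟩
        exact (Set.disjoint_left.1 hd (hsub hy).2 (hsub hy').1).elim
    choose! O hO hxO hOk using h1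
    refine ⟨(⋂ h ∈ H, O h) ×ˢ {p}, ?_, ?_, ?_⟩
    · exact (H.finite_toSet.isClopen_biInter hO).prod (isClopen_discrete _)
    · exact ⟨Set.mem_iInter₂.2 hxO, rfl⟩
    · rintro ⟨a, pa⟩ ⟨ha, hpa⟩ ⟨b, pb⟩ ⟨hb, hpb⟩ ⟨h, hh, hab, hk⟩
      dsimp only at *
      simp only [Set.mem_singleton_iff] at hpa hpb
      subst hpa hpb hab
      exact hOk h hh a (Set.mem_iInter₂.1 ha h hh) (Set.mem_iInter₂.1 hb h hh) hk
  choose O hO hmem hOi using hnhd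
  have : SecondCountableTopology P := inferInstance
  obtain ⟨s, hs, hcov⟩ := TopologicalSpace.countable_cover_nhds
    (f := O) fun y => (hO y).isOpen.mem_nhds (hmem y)
  obtain ⟨U, hUc, hUi, hUcov⟩ : ∃ U : ℕ → Set (X × P), (∀ n, IsClopen (U n)) ∧
      (∀ n, ∀ a ∈ U n, ∀ b ∈ U n, ¬ r a b) ∧ ⋃ n, U n = Set.univ := by
    rcases s.eq_empty_or_nonempty with rfl | hne
    · refine ⟨fun _ => ∅, fun _ => isClopen_empty, fun _ a ha => absurd ha (Set.notMem_empty a), ?_⟩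
      simpa using hcov
    · obtain ⟨e, rfl⟩ := hs.exists_eq_range hne
      exact ⟨fun n => O (e n), fun n => hO _, fun n => hOi _, by simpa using hcov⟩
  obtain ⟨A, hA, hAV, hAi, hAm⟩ := exists_isClopen_maximal_independent r hr
    {y : X × P | V y.2 y.1} hVc.isClosed hopen hclosed (fun n => U n ∩ {y : X × P | V y.2 y.1})
    (fun n => (hUc n).inter hVc) (fun n a ha b hb => hUi n a ha.1 b hb.1)
    (by rw [← Set.iUnion_inter, hUcov, Set.univ_inter])
  refine ⟨fun p x => (x, p) ∈ A, fun p => ?_, fun p x h => hAV h, fun h hh p p' x h1 h2 h3 =>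
    hAi _ h1 _ h2 ⟨h, hh, rfl, h3⟩, fun p x hv => ?_⟩
  · refine isLocallyConstant_of_isClopen ?_
    exact hA.preimage (continuous_id.prodMk continuous_const)
  · by_cases hx : (x, p) ∈ A
    · exact Or.inl hx
    · obtain ⟨⟨x', p'⟩, ha, hra⟩ := hAm (x, p) hv hx
      obtain ⟨h, hh, h1, h2⟩ := hr _ _ hra
      dsimp only at h1 h2
      subst h1
      exact Or.inr ⟨h, hh, p', ha, h2⟩

/-! ### Counting patterns -/

section Counting

variable {G : Type*} {k : ℕ}

open Classical in
/-- The extension of a pattern on `Q` by the constant `z`. -/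
noncomputable def extendPattern {Q : Finset G} (z : Fin k) (p : Q → Fin k) (τ : G) : Fin k :=
  if h : τ ∈ Q then p ⟨τ, h⟩ else z

theorem extendPattern_apply {Q : Finset G} (z : Fin k) (p : Q → Fin k) (τ : Q) :
    extendPattern z p τ = p τ := by
  simp [extendPattern]

/-- A set of patterns that are determined by their values off a set of size at least `N`. -/
theorem card_le_of_determined {Q I : Finset G} (hI : I ⊆ Q) {N : ℕ} (hN : N ≤ I.card) (hk : 0 < k)
    (B : Finset (Q → Fin k))
    (hB : ∀ p ∈ B, ∀ q ∈ B, (∀ τ : Q, τ.1 ∉ I → p τ = q τ) → p = q) :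
    B.card ≤ k ^ (Q.card - N) := by
  classical
  let res : (Q → Fin k) → ({τ : G // τ ∈ Q \ I} → Fin k) :=
    fun p τ => p ⟨τ.1, (Finset.mem_sdiff.1 τ.2).1⟩
  have hinj : Set.InjOn res B := by
    intro p hp q hq hpq
    refine hB p hp q hq fun τ hτ => ?_
    exact congrFun hpq ⟨τ.1, Finset.mem_sdiff.2 ⟨τ.2, hτ⟩⟩
  calc B.card ≤ (Finset.univ : Finset ({τ : G // τ ∈ Q \ I} → Fin k)).card :=
        Finset.card_le_card_of_injOn res (fun _ _ => Finset.mem_coe.2 (Finset.mem_univ _)) hinj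
    _ = k ^ (Q.card - I.card) := by
        rw [Finset.card_univ, Fintype.card_fun, Fintype.card_fin, Fintype.card_coe,
          Finset.card_sdiff_of_subset hI]
    _ ≤ k ^ (Q.card - N) := Nat.pow_le_pow_right hk (by omega)

theorem card_le_of_prescribed {Q I : Finset G} (hI : I ⊆ Q) {N : ℕ} (hN : N ≤ I.card) (hk : 0 < k)
    (z : Fin k) (c : G → Fin k) (B : Finset (Q → Fin k))
    (hB : ∀ p ∈ B, ∀ τ ∈ I, extendPattern z p τ = c τ) :
    B.card ≤ k ^ (Q.card - N) := by
  refine card_le_of_determined hI hN hk B fun p hp q hq h => funext fun τ => ?_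
  by_cases hτ : τ.1 ∈ I
  · rw [← extendPattern_apply z p, ← extendPattern_apply z q, hB p hp _ hτ, hB q hq _ hτ]
  · exact h τ hτ

/-- Each equation expresses an entry on `I` through one of smaller rank, so induction on the rank
recovers the pattern from its values off `I`. This covers coincidences of a pattern with its own
translate. -/
theorem card_le_of_recursive {Q I : Finset G} (hI : I ⊆ Q) {N : ℕ} (hN : N ≤ I.card) (hk : 0 < k)
    (z : Fin k) (φ : G → G) (rank : G → ℕ) (hφ : ∀ τ ∈ I, rank (φ τ) < rank τ)
    (B : Finset (Q → Fin k))
    (hB : ∀ p ∈ B, ∀ τ ∈ I, extendPattern z p τ = extendPattern z p (φ τ)) :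
    B.card ≤ k ^ (Q.card - N) := by
  refine card_le_of_determined hI hN hk B fun p hp q hq h => ?_
  have key : ∀ n, ∀ τ, rank τ = n → extendPattern z p τ = extendPattern z q τ := by
    intro n
    induction n using Nat.strong_induction_on with
    | _ n ih =>
      intro τ hτ
      by_cases hI' : τ ∈ I
      · rw [hB p hp τ hI', hB q hq τ hI']
        exact ih _ (hτ ▸ hφ τ hI') _ rfl
      · by_cases hQ : τ ∈ Q
        · have := h ⟨τ, hQ⟩ hI'
          simpa [extendPattern, hQ] using this
        · simp [extendPattern, hQ]
  funext τ
  rw [← extendPattern_apply z p, ← extendPattern_apply z q]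
  exact key _ _ rfl

/-- The window size will be linear in `N` and the number of conflicts polynomial in the window size,
so `2 ^ N` eventually wins. -/
theorem exists_mul_pow_lt_two_pow (C a d : ℕ) : ∃ N, C * (a * (4 * N + 2)) ^ d < 2 ^ N := by
  have h := tendsto_pow_const_div_const_pow_of_one_lt d (one_lt_two : (1 : ℝ) < 2)
  have hc : (0 : ℝ) < 1 / (C * (a * 6) ^ d + 1) := by positivity
  obtain ⟨N, hN, hN1⟩ := ((h.eventually (gt_mem_nhds hc)).and (Filter.eventually_ge_atTop 1)).exists
  refine ⟨N, ?_⟩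
  rw [div_lt_div_iff₀ (by positivity) (by positivity), one_mul] at hN
  have h1 : (N ^ d * (C * (a * 6) ^ d + 1) : ℕ) < 2 ^ N := by exact_mod_cast hN
  calc C * (a * (4 * N + 2)) ^ d ≤ C * (a * (6 * N)) ^ d := by gcongr; omega
    _ = N ^ d * (C * (a * 6) ^ d) := by rw [← mul_assoc, mul_pow]; ring
    _ ≤ N ^ d * (C * (a * 6) ^ d + 1) := by gcongr; omega
    _ < 2 ^ N := h1

theorem isLocallyConstant_filter {X : Type*} [TopologicalSpace X] {s : X → Finset G} (hs : IsLocallyConstant s) {P : G → X → Prop}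
    [∀ x, DecidablePred fun τ => P τ x] (hP : ∀ τ, IsLocallyConstant (P τ)) :
    IsLocallyConstant fun x => (s x).filter fun τ => P τ x := by
  refine isLocallyConstant_of_eventually fun x => ?_
  have h : ∀ᶠ y in 𝓝 x, ∀ τ ∈ s x, P τ y = P τ x :=
    (Filter.eventually_all_finset _).2 fun τ _ => (hP τ).eventually_eq x
  filter_upwards [h, hs.eventually_eq x] with y hy hsy
  ext τ
  simp only [Finset.mem_filter, hsy]
  exact and_congr_right fun hτ => by rw [hy τ hτ]

end Counting

/-! ### Choosing a pattern at every marker -/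

variable {G : Type*} [Group G] {X : Type*} [TopologicalSpace X] [MulAction G X]
  [ContinuousConstSMul G X]

/-- Every point of a clopen set `M` can be given a pattern on `Q`, in a locally constant way, so
that patterns avoid prescribed coincidences with `f₀`, with their own translates, and with the
patterns of other points of `M`. -/
theorem exists_isLocallyConstant_pattern [T2Space X] [SecondCountableTopology X]
    (hX : IsZeroDimensional X) {k : ℕ} (z : Fin k) (Q H D E : Finset G) (N : ℕ) (hNQ : N ≤ Q.card)
    (hfree : ∀ h ∈ H, ∀ x : X, h • x = x → h = 1) (hH : 1 ∈ H) (hHinv : ∀ h ∈ H, h⁻¹ ∈ H)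
    (hDinv : ∀ d ∈ D, d⁻¹ ∈ D) (hcard : H.card * D.card + 2 * E.card < k ^ N)
    (rank : G → ℕ) (M W : X → Prop) (hM : IsLocallyConstant M) (hW : IsLocallyConstant W)
    (f₀ : X → Fin k) (hf₀ : IsLocallyConstant f₀) (s : X → Finset G) (hs : IsLocallyConstant s)
    (hsQ : ∀ x, s x ⊆ Q) :
    ∃ c : X → (Q → Fin k), IsLocallyConstant c ∧ ∀ x, M x →
      (∀ d ∈ E, ∀ I : Finset G, (∀ τ, τ ∈ I ↔ τ ∈ s x ∧ W (τ • d • x)) → N ≤ I.card →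
        ∃ τ ∈ I, extendPattern z (c x) τ ≠ f₀ (τ • d • x)) ∧
      (∀ d ∈ E, ∀ I : Finset G, (∀ τ, τ ∈ I ↔ τ ∈ s x ∧ τ * d ∈ s x ∧ rank (τ * d) < rank τ) →
        N ≤ I.card → ∃ τ ∈ I, extendPattern z (c x) τ ≠ extendPattern z (c x) (τ * d)) ∧
      (∀ h ∈ H, h ≠ 1 → M (h • x) → ∀ d ∈ D, ∀ I : Finset G,
        (∀ τ, τ ∈ I ↔ τ ∈ s x ∧ τ * d ∈ s (h • x)) → N ≤ I.card →
        ∃ τ ∈ I, extendPattern z (c x) τ ≠ extendPattern z (c (h • x)) (τ * d)) := by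
  classical
  have hk : 0 < k := Fin.pos z
  let I₁ : G → X → Finset G := fun d x => (s x).filter fun τ => W (τ • d • x)
  let I₂ : G → X → Finset G :=
    fun d x => (s x).filter fun τ => τ * d ∈ s x ∧ rank (τ * d) < rank τ
  let I₃ : G → G → X → Finset G := fun h d x => (s x).filter fun τ => τ * d ∈ s (h • x)
  let e := extendPattern (Q := Q) z
  let bad₁ : G → (Q → Fin k) → X → Prop := fun d p x =>
    N ≤ (I₁ d x).card ∧ ∀ τ ∈ I₁ d x, e p τ = f₀ (τ • d • x)
  let bad₂ : G → (Q → Fin k) → X → Prop := fun d p x =>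
    N ≤ (I₂ d x).card ∧ ∀ τ ∈ I₂ d x, e p τ = e p (τ * d)
  let bad₃ : G → G → (Q → Fin k) → (Q → Fin k) → X → Prop := fun h d p p' x =>
    N ≤ (I₃ h d x).card ∧ ∀ τ ∈ I₃ h d x, e p τ = e p' (τ * d)
  have hI₁ : ∀ d, IsLocallyConstant (I₁ d) := fun d =>
    isLocallyConstant_filter hs fun τ => (hW.smul_left τ).smul_left d
  have hI₂ : ∀ d, IsLocallyConstant (I₂ d) := fun d => hs.comp fun t =>
    t.filter fun τ => τ * d ∈ t ∧ rank (τ * d) < rank τ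
  have hI₃ : ∀ h d, IsLocallyConstant (I₃ h d) := fun h d =>
    isLocallyConstant_filter hs fun τ => (hs.smul_left h).comp fun t => τ * d ∈ t
  have hb₁ : ∀ d p, IsLocallyConstant (bad₁ d p) := by
    intro d p
    refine isLocallyConstant_of_eventually fun x => ?_
    have h : ∀ᶠ y in 𝓝 x, ∀ τ ∈ I₁ d x, f₀ (τ • d • y) = f₀ (τ • d • x) :=
      (Filter.eventually_all_finset _).2 fun τ _ =>
        ((hf₀.smul_left τ).smul_left d).eventually_eq x
    filter_upwards [h, (hI₁ d).eventually_eq x] with y hy hIy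
    simp only [bad₁, hIy]
    exact propext (and_congr_right fun _ => forall₂_congr fun τ hτ => by rw [hy τ hτ])
  have hb₂ : ∀ d p, IsLocallyConstant (bad₂ d p) := fun d p => (hI₂ d).comp fun I =>
    N ≤ I.card ∧ ∀ τ ∈ I, e p τ = e p (τ * d)
  have hb₃ : ∀ h d p p', IsLocallyConstant (bad₃ h d p p') := fun h d p p' =>
    (hI₃ h d).comp fun I => N ≤ I.card ∧ ∀ τ ∈ I, e p τ = e p' (τ * d)
  -- The clause for `h = 1` makes distinct patterns at the same point conflict, so that a point
  -- carries at most one.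
  let K : G → (Q → Fin k) → (Q → Fin k) → X → Prop := fun h p p' x =>
    (h = 1 ∧ p ≠ p') ∨ (h ≠ 1 ∧ ∃ d ∈ D, bad₃ h d p p' x)
  let V : (Q → Fin k) → X → Prop := fun p x => M x ∧ ∀ d ∈ E, ¬ bad₁ d p x ∧ ¬ bad₂ d p x
  have hK : ∀ h p p', IsLocallyConstant (K h p p') := by
    intro h p p'
    refine isLocallyConstant_of_eventually fun x => ?_
    have h1 : ∀ᶠ y in 𝓝 x, ∀ d ∈ D, bad₃ h d p p' y = bad₃ h d p p' x :=
      (Filter.eventually_all_finset _).2 fun d _ => (hb₃ h d p p').eventually_eq x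
    filter_upwards [h1] with y hy
    exact propext (or_congr_right (and_congr_right fun _ =>
      exists_congr fun d => and_congr_right fun hd => by rw [hy d hd]))
  have hV : ∀ p, IsLocallyConstant (V p) := by
    intro p
    refine isLocallyConstant_of_eventually fun x => ?_
    have h1 : ∀ᶠ y in 𝓝 x, ∀ d ∈ E, bad₁ d p y = bad₁ d p x ∧ bad₂ d p y = bad₂ d p x :=
      (Filter.eventually_all_finset _).2 fun d _ =>
        ((hb₁ d p).eventually_eq x).and ((hb₂ d p).eventually_eq x)
    filter_upwards [h1, hM.eventually_eq x] with y hy hMy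
    simp only [V, hMy]
    exact propext (and_congr_right fun _ => forall₂_congr fun d hd => by
      rw [(hy d hd).1, (hy d hd).2])
  obtain ⟨A, hA, hAV, hAi, hAm⟩ := exists_maximal_conflictFree hX H K hK (by
    rintro h hh p p' x (⟨rfl, hp⟩ | ⟨h1, d, hd, hc, hag⟩)
    · exact ⟨by simpa using hh, Or.inl ⟨by simp, hp.symm⟩⟩
    · refine ⟨hHinv h hh, Or.inr ⟨by simpa using h1, d⁻¹, hDinv d hd, ?_, ?_⟩⟩
      · refine hc.trans (Finset.card_le_card_of_injOn (· * d) ?_ (mul_left_injective d).injOn)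
        intro τ hτ
        simp only [I₃, Finset.coe_filter, Set.mem_ofPred_eq] at hτ ⊢
        simpa using hτ.symm
      · intro τ hτ
        simp only [I₃, Finset.mem_filter, inv_smul_smul] at hτ
        have := hag (τ * d⁻¹) (by simpa [I₃] using hτ.symm)
        simpa using this.symm) (by
    rintro h hh p x (⟨-, hp⟩ | ⟨h1, -⟩) hx
    · exact hp rfl
    · exact h1 (hfree h hh x hx)) V hV
  have huniq : ∀ p p' x, A p x → A p' x → p = p' := by
    intro p p' x hp hp'
    by_contra hne
    exact hAi 1 hH p p' x hp (by simpa using hp') (Or.inl ⟨rfl, hne⟩)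
  have hex : ∀ x, M x → ∃ p, A p x := by
    intro x hx
    -- If `x` has no pattern, maximality makes every pattern invalid or in conflict with the pattern
    -- at some `h • x` with `h ≠ 1`. The bounds below show that these exclusions cannot exhaust all
    -- patterns.
    by_contra! hno
    let B₁ : G → Finset (Q → Fin k) := fun d => Finset.univ.filter fun p => bad₁ d p x
    let B₂ : G → Finset (Q → Fin k) := fun d => Finset.univ.filter fun p => bad₂ d p x
    let B₃ : G × G → Finset (Q → Fin k) := fun hd =>
      Finset.univ.filter fun p => ∃ p', A p' (hd.1 • x) ∧ bad₃ hd.1 hd.2 p p' x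
    have c₁ : ∀ d, (B₁ d).card ≤ k ^ (Q.card - N) := by
      intro d
      by_cases hc : N ≤ (I₁ d x).card
      · exact card_le_of_prescribed ((Finset.filter_subset _ _).trans (hsQ x)) hc hk z
          (fun τ => f₀ (τ • d • x)) _ fun p hp => (Finset.mem_filter.1 hp).2.2
      · rw [Finset.card_eq_zero.2 (Finset.filter_eq_empty_iff.2 fun p _ hp => hc hp.1)]
        exact Nat.zero_le _
    have c₂ : ∀ d, (B₂ d).card ≤ k ^ (Q.card - N) := by
      intro d
      by_cases hc : N ≤ (I₂ d x).card
      · exact card_le_of_recursive ((Finset.filter_subset _ _).trans (hsQ x)) hc hk z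
          (· * d) rank (fun τ hτ => (Finset.mem_filter.1 hτ).2.2) _
          fun p hp => (Finset.mem_filter.1 hp).2.2
      · rw [Finset.card_eq_zero.2 (Finset.filter_eq_empty_iff.2 fun p _ hp => hc hp.1)]
        exact Nat.zero_le _
    have c₃ : ∀ hd, (B₃ hd).card ≤ k ^ (Q.card - N) := by
      rintro ⟨h, d⟩
      rcases (B₃ (h, d)).eq_empty_or_nonempty with he | ⟨p₀, hp₀⟩
      · rw [he, Finset.card_empty]
        exact Nat.zero_le _
      · obtain ⟨p', hp', hc, -⟩ := (Finset.mem_filter.1 hp₀).2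
        refine card_le_of_prescribed ((Finset.filter_subset _ _).trans (hsQ x)) hc hk z
          (fun τ => e p' (τ * d)) _ fun p hp => ?_
        obtain ⟨p'', hp'', -, hag⟩ := (Finset.mem_filter.1 hp).2
        rwa [huniq _ _ _ hp'' hp'] at hag
    have hcov : (Finset.univ : Finset (Q → Fin k)) ⊆
        (H ×ˢ D).biUnion B₃ ∪ (E.biUnion B₁ ∪ E.biUnion B₂) := by
      intro p _
      by_cases hp : V p x
      · obtain h | ⟨h, hh, p', hp', ⟨rfl, -⟩ | ⟨-, d, hd, hb⟩⟩ := hAm p x hp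
        · exact absurd h (hno p)
        · exact absurd hp' (by simpa using hno p')
        · exact Finset.mem_union_left _ (Finset.mem_biUnion.2 ⟨(h, d), Finset.mk_mem_product hh hd,
            Finset.mem_filter.2 ⟨Finset.mem_univ _, p', hp', hb⟩⟩)
      · refine Finset.mem_union_right _ ?_
        simp only [V, hx, true_and, not_forall] at hp
        obtain ⟨d, hd, hb⟩ := hp
        by_cases h1 : bad₁ d p x
        · exact Finset.mem_union_left _ (Finset.mem_biUnion.2 ⟨d, hd,
            Finset.mem_filter.2 ⟨Finset.mem_univ _, h1⟩⟩)
        · exact Finset.mem_union_right _ (Finset.mem_biUnion.2 ⟨d, hd,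
            Finset.mem_filter.2 ⟨Finset.mem_univ _, by tauto⟩⟩)
    have h1 := Finset.card_le_card hcov
    rw [Finset.card_univ, Fintype.card_fun, Fintype.card_fin, Fintype.card_coe] at h1
    have h2 := (Finset.card_union_le ((H ×ˢ D).biUnion B₃) (E.biUnion B₁ ∪ E.biUnion B₂)).trans
      (add_le_add (Finset.card_biUnion_le_card_mul _ _ _ fun hd _ => c₃ hd)
        ((Finset.card_union_le _ _).trans (add_le_add
          (Finset.card_biUnion_le_card_mul _ _ _ fun d _ => c₁ d)
          (Finset.card_biUnion_le_card_mul _ _ _ fun d _ => c₂ d))))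
    rw [Finset.card_product] at h2
    have h3 : (H.card * D.card + 2 * E.card) * k ^ (Q.card - N) < k ^ Q.card := by
      calc _ < k ^ N * k ^ (Q.card - N) := Nat.mul_lt_mul_of_pos_right hcard (pow_pos hk _)
        _ = k ^ Q.card := by rw [← pow_add, Nat.add_sub_cancel' hNQ]
    have h4 := (h1.trans h2).trans_eq
      (show _ = (H.card * D.card + 2 * E.card) * k ^ (Q.card - N) by ring)
    omega
  obtain ⟨c, hc, hcA⟩ := exists_isLocallyConstant_choice (fun p x => M x → A p x)
    (fun p => hM.comp₂ (hA p) fun a b => a → b) (fun x => by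
      by_cases hx : M x
      · obtain ⟨p, hp⟩ := hex x hx
        exact ⟨p, fun _ => hp⟩
      · exact ⟨fun _ => z, fun h => absurd h hx⟩)
  refine ⟨c, hc, fun x hx => ⟨fun d hd I hI hcI => ?_, fun d hd I hI hcI => ?_,
    fun h hh h1 hMh d hd I hI hcI => ?_⟩⟩
  · have hI' : I = I₁ d x := by ext τ; simp [I₁, hI]
    by_contra! hcon
    exact ((hAV _ x (hcA x hx)).2 d hd).1 ⟨hI' ▸ hcI, hI' ▸ hcon⟩
  · have hI' : I = I₂ d x := by ext τ; simp [I₂, hI]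
    by_contra! hcon
    exact ((hAV _ x (hcA x hx)).2 d hd).2 ⟨hI' ▸ hcI, hI' ▸ hcon⟩
  · have hI' : I = I₃ h d x := by ext τ; simp [I₃, hI]
    by_contra! hcon
    exact hAi h hh _ _ x (hcA x hx) (hcA _ hMh) (Or.inr ⟨h1, d, hd, hI' ▸ hcI, hI' ▸ hcon⟩)

/-! ### Slots of markers and the pigeonhole argument -/

section Slots

variable {G : Type*} [Group G] {X : Type*} [MulAction G X]

open Classical in
/-- The elements of `Q` that move `x` off `C`, apart from a reserved one. -/
noncomputable def slots (Q : Finset G) (C : Set X) (r : X → G) (x : X) : Finset G :=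
  Q.filter fun τ => τ • x ∉ C ∧ τ ≠ r x

theorem mem_slots {Q : Finset G} {C : Set X} {r : X → G} {x : X} {τ : G} :
    τ ∈ slots Q C r x ↔ τ ∈ Q ∧ τ • x ∉ C ∧ τ ≠ r x := by
  simp [slots]

-- Choose `t a ∈ T` moving `a • x` off `C`. The map `a ↦ t a * a` is at most `|T|`-to-one, since `a`
-- is recovered from its image and `t a`.
open Classical in
theorem card_le_mul_card_filter {T : Finset G} {C : Set X} (hT : ∀ x : X, ∃ τ ∈ T, τ • x ∉ C)
    (A : Finset G) (x : X) :
    A.card ≤ T.card * ((Finset.image₂ (· * ·) T A).filter fun τ => τ • x ∉ C).card := by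
  choose t htT htC using fun a : G => hT (a • x)
  have h1 := Finset.card_le_mul_card_image (f := fun a => t a * a) A T.card (by
    intro b _
    refine Finset.card_le_card_of_injOn (fun a => t a) (fun a _ => htT a) ?_
    intro a ha a' ha' h
    simp only [Finset.coe_filter, Set.mem_ofPred_eq] at ha ha'
    have h2 := ha.2.trans ha'.2.symm
    dsimp only at h
    rw [h] at h2
    exact mul_left_cancel h2)
  refine h1.trans (Nat.mul_le_mul_left _ (Finset.card_le_card fun b hb => ?_))
  obtain ⟨a, ha, rfl⟩ := Finset.mem_image.1 hb
  refine Finset.mem_filter.2 ⟨Finset.mem_image₂_of_mem (htT a) ha, ?_⟩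
  rw [mul_smul]
  exact htC a

/-- A set of markers is separated with respect to `Q` if distinct markers have, in a strong sense,
disjoint `Q`-neighbourhoods. -/
def IsSeparated (Q : Finset G) (M : X → Prop) : Prop :=
  ∀ a ∈ Q, ∀ b ∈ Q, ∀ c ∈ Q, ∀ d ∈ Q, ∀ x, M x → M ((a⁻¹ * b * (c⁻¹ * d)) • x) →
    a⁻¹ * b * (c⁻¹ * d) = 1

theorem IsSeparated.eq_of_smul_eq {Q : Finset G} {M : X → Prop} (hM : IsSeparated Q M)
    {τ τ' : G} (hτ : τ ∈ Q) (hτ' : τ' ∈ Q) {x x' : X} (hx : M x) (hx' : M x')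
    (h : τ • x = τ' • x') : τ = τ' ∧ x = x' := by
  have h1 : x' = (τ'⁻¹ * τ * (τ⁻¹ * τ)) • x := by
    rw [inv_mul_cancel, mul_one, mul_smul, h, inv_smul_smul]
  have h2 := hM _ hτ' _ hτ _ hτ _ hτ x hx (h1 ▸ hx')
  rw [inv_mul_cancel, mul_one, inv_mul_eq_one] at h2
  subst h2
  exact ⟨rfl, (smul_left_cancel _ h)⟩

/-- Among the points `τ • g • m`, for slots `τ` of `m`, either `N` keep their old colour, or the
others all lie near a single marker, by separation. That marker is either another one, handled by
`hc₃`, or `m` itself, handled by `hc₂`. -/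
theorem exists_differing_slot {k : ℕ} {z : Fin k} {Q H E : Finset G} {N : ℕ} {C : Set X}
    {M : X → Prop} {r : X → G} (hsep : IsSeparated Q M)
    {D : Finset G} (hD : ∀ a ∈ Q, ∀ b ∈ Q, a⁻¹ * b ∈ D)
    (hH : ∀ d ∈ D, ∀ g ∈ E, d * g ∈ H) (hE : ∀ g ∈ E, g⁻¹ ∈ E)
    {rank : G → ℕ} (hrank : Function.Injective rank) {f f' : X → Fin k} {c : X → (Q → Fin k)}
    {s : X → Finset G} (hs : s = slots Q C r)
    (hf' : ∀ x, M x → ∀ τ ∈ s x, f' (τ • x) = extendPattern z (c x) τ)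
    {W : X → Prop} (hW : ∀ x, W x ↔ ¬ (x ∉ C ∧ ∃ τ ∈ Q, M (τ⁻¹ • x)))
    (hfW : ∀ x, W x → f' x = f x) {m : X} (hm : M m) (hcard : 4 * N + 1 ≤ (s m).card)
    (hc₁ : ∀ d ∈ E, ∀ I : Finset G, (∀ τ, τ ∈ I ↔ τ ∈ s m ∧ W (τ • d • m)) → N ≤ I.card →
        ∃ τ ∈ I, extendPattern z (c m) τ ≠ f (τ • d • m))
    (hc₂ : ∀ d ∈ E, ∀ I : Finset G,
        (∀ τ, τ ∈ I ↔ τ ∈ s m ∧ τ * d ∈ s m ∧ rank (τ * d) < rank τ) →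
        N ≤ I.card → ∃ τ ∈ I, extendPattern z (c m) τ ≠ extendPattern z (c m) (τ * d))
    (hc₃ : ∀ h ∈ H, h ≠ 1 → M (h • m) → ∀ d ∈ D, ∀ I : Finset G,
        (∀ τ, τ ∈ I ↔ τ ∈ s m ∧ τ * d ∈ s (h • m)) → N ≤ I.card →
        ∃ τ ∈ I, extendPattern z (c m) τ ≠ extendPattern z (c (h • m)) (τ * d))
    {g : G} (hg : g ∈ E) (hg1 : g ≠ 1) :
    ∃ τ ∈ s m, f' (τ • m) ≠ f' (τ • g • m) ∧
      (W (τ • g • m) ∨ ∃ x, M x ∧ ∃ τ' ∈ s x, τ • g • m = τ' • x) := by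
  classical
  let I₁ := (s m).filter fun τ => W (τ • g • m)
  by_cases h₁ : N ≤ I₁.card
  · obtain ⟨τ, hτ, hne⟩ := hc₁ g hg I₁ (fun τ => by simp [I₁]) h₁
    obtain ⟨hτs, hτW⟩ := Finset.mem_filter.1 hτ
    exact ⟨τ, hτs, by rwa [hf' m hm τ hτs, hfW _ hτW], Or.inl hτW⟩
  let J := (s m).filter fun τ => ¬ W (τ • g • m)
  have hJ : 3 * N + 2 ≤ J.card := by
    have : I₁.card + J.card = (s m).card := Finset.card_filter_add_card_filter_not _
    omega
  obtain ⟨τ₀, hτ₀⟩ := Finset.card_pos.1 (show 0 < J.card by omega)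
  have hsQ : ∀ x τ, τ ∈ s x → τ ∈ Q := fun x τ h => by rw [hs] at h; exact (mem_slots.1 h).1
  obtain ⟨hτ₀s, hτ₀W⟩ := Finset.mem_filter.1 hτ₀
  rw [hW, not_not] at hτ₀W
  obtain ⟨-, τ₁, hτ₁, hM₁⟩ := hτ₀W
  have hτ₀Q := hsQ _ _ hτ₀s
  set e := τ₁⁻¹ * τ₀ with he
  rw [smul_smul, ← he] at hM₁
  have heD : e ∈ D := hD _ hτ₁ _ hτ₀Q
  have hedD : e⁻¹ ∈ D := by
    have := hD _ hτ₀Q _ hτ₁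
    rwa [he, mul_inv_rev, inv_inv]
  -- Separation makes the marker `e • g • m` found from `τ₀` serve every `τ ∈ J`, with the same
  -- offset `e⁻¹`.
  have key : ∀ τ ∈ J, τ * e⁻¹ ∈ Q ∧ τ • g • m = (τ * e⁻¹) • e • g • m ∧ τ • g • m ∉ C := by
    intro τ hτ
    obtain ⟨hτs, hτW⟩ := Finset.mem_filter.1 hτ
    rw [hW, not_not] at hτW
    obtain ⟨hC, τ₂, hτ₂, hM₂⟩ := hτW
    have h1 : τ₂⁻¹ • τ • g • m = (τ₂⁻¹ * τ * (τ₀⁻¹ * τ₁)) • e • g • m := by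
      simp only [smul_smul, he]
      congr 1
      group
    have h2 := hsep _ hτ₂ _ (hsQ _ _ hτs) _ hτ₀Q _ hτ₁ _ hM₁ (h1 ▸ hM₂)
    have h3 : τ * e⁻¹ = τ₂ := by
      rw [mul_assoc, inv_mul_eq_one] at h2
      rw [he, mul_inv_rev, inv_inv, ← h2]
    exact ⟨h3 ▸ hτ₂, by rw [smul_smul, smul_smul, smul_smul]; congr 1; group, hC⟩
  let I₃ := (s m).filter fun τ => τ * e⁻¹ ∈ s (e • g • m)
  -- Only the reserved position of the second marker can be lost.
  have hJI : J ⊆ insert (r (e • g • m) * e) I₃ := by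
    intro τ hτ
    obtain ⟨h1, h2, h3⟩ := key τ hτ
    by_cases hr : τ * e⁻¹ = r (e • g • m)
    · exact Finset.mem_insert.2 (Or.inl (by rw [← hr]; group))
    · refine Finset.mem_insert_of_mem (Finset.mem_filter.2 ⟨(Finset.mem_filter.1 hτ).1, ?_⟩)
      rw [hs]
      exact mem_slots.2 ⟨h1, h2 ▸ h3, hr⟩
  have hI₃ : 3 * N + 1 ≤ I₃.card := by
    have := (Finset.card_le_card hJI).trans (Finset.card_insert_le _ _)
    omega
  by_cases heg : e * g = 1
  · have hgm : e • g • m = m := by rw [smul_smul, heg, one_smul]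
    have heg' : e⁻¹ = g := inv_eq_of_mul_eq_one_right heg
    have hdone : ∀ τ ∈ s m, τ * g ∈ s m →
        extendPattern z (c m) τ ≠ extendPattern z (c m) (τ * g) →
        ∃ τ ∈ s m, f' (τ • m) ≠ f' (τ • g • m) ∧
          (W (τ • g • m) ∨ ∃ x, M x ∧ ∃ τ' ∈ s x, τ • g • m = τ' • x) := by
      intro τ hτ hτg hne
      refine ⟨τ, hτ, ?_, Or.inr ⟨m, hm, τ * g, hτg, smul_smul _ _ _⟩⟩
      rwa [smul_smul, hf' m hm _ hτ, hf' m hm _ hτg]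
    let A : G → Finset G := fun d =>
      (s m).filter fun τ => τ * d ∈ s m ∧ rank (τ * d) < rank τ
    -- Ranks differ because `g ≠ 1`. When translation by `g` raises the rank, the pair is read
    -- backwards, from `τ * g` with `g⁻¹`. One of the two parts has at least `N` elements.
    have hsub : I₃ ⊆ A g ∪ (A g⁻¹).image (· * g⁻¹) := by
      intro τ hτ
      obtain ⟨h1, h2⟩ := Finset.mem_filter.1 hτ
      rw [hgm, heg'] at h2
      rcases lt_trichotomy (rank (τ * g)) (rank τ) with h | h | h
      · exact Finset.mem_union_left _ (Finset.mem_filter.2 ⟨h1, h2, h⟩)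
      · exact absurd (mul_eq_left.1 (hrank h)) hg1
      · refine Finset.mem_union_right _ (Finset.mem_image.2 ⟨τ * g, ?_, by simp⟩)
        exact Finset.mem_filter.2 ⟨h2, by simpa using h1, by simpa using h⟩
    have hle := ((Finset.card_le_card hsub).trans (Finset.card_union_le _ _)).trans
      (Nat.add_le_add_left Finset.card_image_le _)
    by_cases hA : N ≤ (A g).card
    · obtain ⟨τ, hτ, hne⟩ := hc₂ g hg (A g) (fun τ => by simp [A]) hA
      obtain ⟨h1, h2, -⟩ := Finset.mem_filter.1 hτ
      exact hdone τ h1 h2 hne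
    · obtain ⟨τ, hτ, hne⟩ := hc₂ g⁻¹ (hE g hg) (A g⁻¹) (fun τ => by simp [A]) (by omega)
      obtain ⟨h1, h2, -⟩ := Finset.mem_filter.1 hτ
      exact hdone _ h2 (by simpa using h1) (by simpa using hne.symm)
  · obtain ⟨τ, hτ, hne⟩ := hc₃ (e * g) (hH e heD g hg) heg (by rwa [mul_smul]) e⁻¹ hedD I₃
      (fun τ => by simp [I₃, mul_smul]) (by omega)
    obtain ⟨h1, h2⟩ := Finset.mem_filter.1 hτ
    have h3 : τ • g • m = (τ * e⁻¹) • e • g • m := by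
      rw [smul_smul, smul_smul, smul_smul]; congr 1; group
    refine ⟨τ, h1, ?_, Or.inr ⟨_, hM₁, _, h2, h3⟩⟩
    rw [h3, hf' m hm _ h1, hf' _ hM₁ _ h2]
    rwa [mul_smul] at hne

end Slots

/-! ### The one-step extension -/

section Step

variable {G : Type*} [Group G]

theorem IsFreeOn.eq_one {S : Finset G} {X : Type*} [MulAction G X] (h : IsFreeOn S X) {g : G}
    (hg : g ∈ S) {x : X} (hx : g • x = x) : g = 1 :=
  h x ⟨hg, hx⟩

open scoped Pointwise in
theorem isSyndetic_iff {X : Type*} [MulAction G X] {T : Finset G} {A : Set X} :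
    IsSyndetic T A ↔ ∀ x : X, ∃ τ ∈ T, τ • x ∈ A := by
  rw [IsSyndetic, Set.eq_univ_iff_forall]
  refine forall_congr' fun x => ?_
  rw [Set.mem_smul]
  constructor
  · rintro ⟨σ, hσ, a, ha, rfl⟩
    exact ⟨σ⁻¹, hσ, by simpa using ha⟩
  · rintro ⟨τ, hτ, h⟩
    exact ⟨τ⁻¹, by simpa using hτ, τ • x, h, by simp⟩

open Classical Pointwise in
/-- Finite sets of parameters for the one-step extension: `Q` is a window which is large compared to
`T`, `D` and `R` measure its overlaps, `E` contains the relevant conjugates of `γ`, and the number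
of possible conflicts is less than `2 ^ N`. -/
theorem exists_step_parameters [Infinite G] (γ : G) (T : Finset G) (hT : T.Nonempty) :
    ∃ (N : ℕ) (A Q D R E H : Finset G), Q = Finset.image₂ (· * ·) T A ∧
      T.card * (4 * N + 2) = A.card ∧ N ≤ Q.card ∧
      (∀ a ∈ Q, ∀ b ∈ Q, a⁻¹ * b ∈ D) ∧ (∀ d ∈ D, d⁻¹ ∈ D) ∧
      (∀ a ∈ D, ∀ b ∈ D, a * b ∈ R) ∧ 1 ∈ R ∧ (∀ a ∈ R, a⁻¹ ∈ R) ∧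
      (∀ a ∈ R, a * γ * a⁻¹ ∈ E) ∧ (∀ g ∈ E, g⁻¹ ∈ E) ∧
      (∀ d ∈ D, ∀ g ∈ E, d * g ∈ H) ∧ 1 ∈ H ∧ (∀ h ∈ H, h⁻¹ ∈ H) ∧
      H.card * D.card + 2 * E.card < 2 ^ N := by
  -- With `n = |Q|`, the number of conflicts is at most `7 * n ^ 14`, and `n ≤ |T|² (4N + 2)`.
  obtain ⟨N, hN⟩ := exists_mul_pow_lt_two_pow 7 (T.card * T.card) 14
  obtain ⟨A, hA⟩ := Infinite.exists_subset_card_eq G (T.card * (4 * N + 2))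
  have hTc : 1 ≤ T.card := hT.card_pos
  have hAc : 4 * N + 2 ≤ A.card := by rw [hA]; exact Nat.le_mul_of_pos_left _ hTc
  have hAne : A.Nonempty := Finset.card_pos.1 (by omega)
  set Q := T * A with hQ
  have hAQ : A.card ≤ Q.card := Finset.card_le_card_mul_left hT
  obtain ⟨q, hq⟩ : Q.Nonempty := Finset.card_pos.1 (by omega)
  set D := Q⁻¹ * Q with hD
  set R := D * D with hR
  set E := R * {γ, γ⁻¹} * R with hE
  set H := (D * E * D) ∪ {1} with hH
  have hDinv : D⁻¹ = D := by rw [hD, mul_inv_rev, inv_inv]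
  have hRinv : R⁻¹ = R := by rw [hR, mul_inv_rev, hDinv]
  have hEinv : E⁻¹ = E := by
    have : ({γ, γ⁻¹} : Finset G)⁻¹ = {γ, γ⁻¹} := by
      ext x; simp [or_comm]
    rw [hE, mul_inv_rev (R * _) R, mul_inv_rev R, hRinv, this, mul_assoc R]
  have hHinv : (D * E * D)⁻¹ = D * E * D := by
    rw [mul_inv_rev (D * E) D, mul_inv_rev D E, hDinv, hEinv, mul_assoc D]
  have inv_mem : ∀ {B : Finset G}, B⁻¹ = B → ∀ b ∈ B, b⁻¹ ∈ B := by
    intro B hB b hb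
    rw [← hB]
    exact Finset.inv_mem_inv hb
  have hDm : ∀ a ∈ Q, ∀ b ∈ Q, a⁻¹ * b ∈ D := fun a ha b hb =>
    Finset.mul_mem_mul (Finset.inv_mem_inv ha) hb
  have h1D : (1 : G) ∈ D := by simpa using hDm q hq q hq
  refine ⟨N, A, Q, D, R, E, H, rfl, hA.symm, by omega, hDm, inv_mem hDinv,
    fun a ha b hb => Finset.mul_mem_mul ha hb, by simpa using Finset.mul_mem_mul h1D h1D,
    inv_mem hRinv, fun a ha => Finset.mul_mem_mul (Finset.mul_mem_mul ha (by simp))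
      (inv_mem hRinv a ha), inv_mem hEinv, fun d hd g hg => ?_, by simp [hH], fun h hh => ?_, ?_⟩
  · refine Finset.mem_union_left _ ?_
    simpa using Finset.mul_mem_mul (Finset.mul_mem_mul hd hg) h1D
  · rcases Finset.mem_union.1 hh with hh | hh
    · exact Finset.mem_union_left _ (inv_mem hHinv h hh)
    · rw [Finset.mem_singleton.1 hh, inv_one]
      exact Finset.mem_union_right _ (Finset.mem_singleton_self 1)
  · set n := Q.card with hn
    have hn1 : 1 ≤ n := by omega
    have hDc : D.card ≤ n ^ 2 := by
      calc D.card ≤ Q⁻¹.card * Q.card := Finset.card_mul_le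
        _ = n ^ 2 := by rw [Finset.card_inv]; ring
    have hRc : R.card ≤ n ^ 4 := by
      calc R.card ≤ D.card * D.card := Finset.card_mul_le
        _ ≤ n ^ 2 * n ^ 2 := Nat.mul_le_mul hDc hDc
        _ = n ^ 4 := by ring
    have hEc : E.card ≤ 2 * n ^ 8 := by
      calc E.card ≤ (R * {γ, γ⁻¹}).card * R.card := Finset.card_mul_le
        _ ≤ (n ^ 4 * 2) * n ^ 4 := Nat.mul_le_mul (Finset.card_mul_le.trans
            (Nat.mul_le_mul hRc Finset.card_le_two)) hRc
        _ = 2 * n ^ 8 := by ring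
    have hHc : H.card ≤ 2 * n ^ 12 + 1 := by
      refine (Finset.card_union_le _ _).trans (Nat.add_le_add ?_ (by simp))
      calc (D * E * D).card ≤ (D * E).card * D.card := Finset.card_mul_le
        _ ≤ (n ^ 2 * (2 * n ^ 8)) * n ^ 2 := Nat.mul_le_mul (Finset.card_mul_le.trans
            (Nat.mul_le_mul hDc hEc)) hDc
        _ = 2 * n ^ 12 := by ring
    have hnle : n ≤ T.card * T.card * (4 * N + 2) := by
      calc n ≤ T.card * A.card := Finset.card_mul_le
        _ = _ := by rw [hA, mul_assoc]
    have hp : ∀ i j, i ≤ j → n ^ i ≤ n ^ j := fun i j h => Nat.pow_le_pow_right hn1 h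
    have h2 := hp 2 14 (by norm_num)
    have h8 := hp 8 14 (by norm_num)
    calc H.card * D.card + 2 * E.card
        ≤ (2 * n ^ 12 + 1) * n ^ 2 + 2 * (2 * n ^ 8) :=
          Nat.add_le_add (Nat.mul_le_mul hHc hDc) (Nat.mul_le_mul_left 2 hEc)
      _ = 2 * n ^ 14 + n ^ 2 + 4 * n ^ 8 := by ring
      _ ≤ 7 * n ^ 14 := by omega
      _ ≤ 7 * (T.card * T.card * (4 * N + 2)) ^ 14 :=
          Nat.mul_le_mul_left 7 (Nat.pow_le_pow_left hnle 14)
      _ < 2 ^ N := hN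

/-- This is conflict-free selection with a single label, any two points related by `R` being in
conflict. Maximality yields the covering property. -/
theorem exists_markers {X : Type*} [TopologicalSpace X] [MulAction G X] [ContinuousConstSMul G X]
    [T2Space X] [SecondCountableTopology X] (hX : IsZeroDimensional X) (R : Finset G)
    (h1 : 1 ∈ R) (hinv : ∀ a ∈ R, a⁻¹ ∈ R) (hfree : ∀ a ∈ R, ∀ x : X, a • x = x → a = 1) :
    ∃ M : X → Prop, IsLocallyConstant M ∧ (∀ a ∈ R, ∀ x, M x → M (a • x) → a = 1) ∧
      ∀ x, ∃ a ∈ R, M (a • x) := by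
  classical
  obtain ⟨A, hA, -, hAi, hAm⟩ := exists_maximal_conflictFree hX (P := Unit) (R.erase 1)
    (fun _ _ _ _ => True) (fun _ _ _ => IsLocallyConstant.const True)
    (fun a ha _ _ _ _ => by
      obtain ⟨ha1, ha⟩ := Finset.mem_erase.1 ha
      exact ⟨Finset.mem_erase.2 ⟨by simpa using ha1, hinv a ha⟩, trivial⟩)
    (fun a ha _ x _ hx => (Finset.mem_erase.1 ha).1 (hfree a (Finset.mem_erase.1 ha).2 x hx))
    (fun _ _ => True) (fun _ => IsLocallyConstant.const True)
  refine ⟨A (), hA (), fun a ha x hx hax => ?_, fun x => ?_⟩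
  · by_contra hne
    exact hAi a (Finset.mem_erase.2 ⟨hne, ha⟩) () () x hx hax trivial
  · obtain h | ⟨a, ha, ⟨⟩, h, -⟩ := hAm () x trivial
    · exact ⟨1, h1, by simpa using h⟩
    · exact ⟨a, (Finset.mem_erase.1 ha).2, h⟩

/-- Painting the patterns `c` onto the slots of the markers and keeping `f` elsewhere. -/
theorem exists_paint {X : Type*} [TopologicalSpace X] [MulAction G X] [ContinuousConstSMul G X]
    {k : ℕ} (z : Fin k) {Q : Finset G} {M : X → Prop} (hM : IsLocallyConstant M)
    (hsep : IsSeparated Q M) {f : X → Fin k} (hf : IsLocallyConstant f) {c : X → (Q → Fin k)}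
    (hc : IsLocallyConstant c) {s : X → Finset G} (hs : IsLocallyConstant s)
    (hsQ : ∀ x, s x ⊆ Q) :
    ∃ f' : X → Fin k, IsLocallyConstant f' ∧
      (∀ x, M x → ∀ τ ∈ s x, f' (τ • x) = extendPattern z (c x) τ) ∧
      ∀ x, (∀ τ ∈ Q, M (τ⁻¹ • x) → τ ∉ s (τ⁻¹ • x)) → f' x = f x := by
  let P : Fin k → X → Prop := fun a x =>
    (∀ τ ∈ Q, M (τ⁻¹ • x) → τ ∈ s (τ⁻¹ • x) → a = extendPattern z (c (τ⁻¹ • x)) τ) ∧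
      ((∀ τ ∈ Q, M (τ⁻¹ • x) → τ ∉ s (τ⁻¹ • x)) → a = f x)
  obtain ⟨f', hf', hP⟩ := exists_isLocallyConstant_choice P (fun a => by
    refine isLocallyConstant_of_eventually fun x => ?_
    have h1 : ∀ᶠ y in 𝓝 x, ∀ τ ∈ Q, M (τ⁻¹ • y) = M (τ⁻¹ • x) ∧ s (τ⁻¹ • y) = s (τ⁻¹ • x) ∧
        c (τ⁻¹ • y) = c (τ⁻¹ • x) :=
      (Filter.eventually_all_finset _).2 fun τ _ => ((hM.smul_left τ⁻¹).eventually_eq x).and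
        (((hs.smul_left τ⁻¹).eventually_eq x).and ((hc.smul_left τ⁻¹).eventually_eq x))
    filter_upwards [h1, hf.eventually_eq x] with y hy hfy
    refine propext (and_congr (forall₂_congr fun τ hτ => ?_) ?_)
    · rw [(hy τ hτ).1, (hy τ hτ).2.1, (hy τ hτ).2.2]
    · rw [hfy]
      exact imp_congr_left (forall₂_congr fun τ hτ => by rw [(hy τ hτ).1, (hy τ hτ).2.1])) (by
    intro x
    by_cases h : ∀ τ ∈ Q, M (τ⁻¹ • x) → τ ∉ s (τ⁻¹ • x)
    · exact ⟨f x, fun τ hτ h1 h2 => absurd h2 (h τ hτ h1), fun _ => rfl⟩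
    · have h' := h
      push Not at h'
      obtain ⟨τ, hτ, h1, h2⟩ := h'
      refine ⟨extendPattern z (c (τ⁻¹ • x)) τ, fun τ' hτ' h1' h2' => ?_, fun h3 => absurd h3 h⟩
      -- By separation at most one marker paints a given point.
      obtain ⟨rfl, -⟩ := hsep.eq_of_smul_eq hτ hτ' h1 h1' (by simp)
      rfl)
  refine ⟨f', hf', fun x hx τ hτ => ?_, fun x hx => (hP x).2 hx⟩
  have := (hP (τ • x)).1 τ (hsQ x hτ) (by simpa using hx) (by simpa using hτ)
  simpa using this

universe u in
/-- One extension step: a partial colouring whose domain `C` leaves a syndetic set uncoloured can be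
extended, again leaving a syndetic set uncoloured, such that `x` and `γ • x` are distinguished
within a finite window, for all `x`. -/
theorem exists_extension_step [Countable G] [Infinite G] {k : ℕ} (hk : 2 ≤ k) (γ : G)
    (T : Finset G) :
    ∃ F T' S : Finset G, ∀ (X : Type u) [TopologicalSpace X] [PolishSpace X] [MulAction G X]
      [ContinuousConstSMul G X], IsZeroDimensional X → IsFreeOn S X →
      ∀ (C : Set X) (f : X → Fin k), IsClopen C → IsLocallyConstant f →
      (∀ x : X, ∃ τ ∈ T, τ • x ∉ C) →
      ∃ (C' : Set X) (f' : X → Fin k), IsClopen C' ∧ IsLocallyConstant f' ∧ C ⊆ C' ∧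
        (∀ x ∈ C, f' x = f x) ∧ (∀ x : X, ∃ τ ∈ T', τ • x ∉ C') ∧
        (γ ≠ 1 → ∀ x : X, ∃ σ ∈ F, σ • x ∈ C' ∧ (σ * γ) • x ∈ C' ∧
          f' (σ • x) ≠ f' ((σ * γ) • x)) := by
  classical
  by_cases hγ : γ = 1
  · exact ⟨∅, T, ∅, fun X _ _ _ _ _ _ C f hC hf hT => ⟨C, f, hC, hf, subset_rfl, fun _ _ => rfl, hT,
      fun h => absurd hγ h⟩⟩
  -- Inserting `1` guarantees nonemptiness, as `T` itself may be empty.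
  obtain ⟨N, A, Q, D, R, E, H, hQ, hA, hNQ, hQD, hDinv, hDR, h1R, hRinv, hRE, hEinv, hDE, h1H, hHinv,
    hcard⟩ := exists_step_parameters γ (insert 1 T) (Finset.insert_nonempty _ _)
  obtain ⟨rank, hrank⟩ := exists_injective_nat G
  refine ⟨Finset.image₂ (· * ·) Q R, Finset.image₂ (· * ·) Q R, R ∪ H, ?_⟩
  intro X _ _ _ _ hX hfree C f hC hf hT
  have z : Fin k := ⟨0, by omega⟩
  have hT' : ∀ x : X, ∃ τ ∈ insert 1 T, τ • x ∉ C := fun x =>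
    (hT x).imp fun τ h => ⟨Finset.mem_insert_of_mem h.1, h.2⟩
  have hfilter : ∀ x : X, 4 * N + 2 ≤ (Q.filter fun τ => τ • x ∉ C).card := by
    intro x
    have h := card_le_mul_card_filter hT' A x
    rw [← hQ, ← hA] at h
    exact Nat.le_of_mul_le_mul_left h (Finset.insert_nonempty _ _).card_pos
  have hCl : IsLocallyConstant fun x => x ∉ C := isLocallyConstant_of_isClopen hC.compl
  obtain ⟨M, hM, hMs, hMc⟩ := exists_markers hX R h1R hRinv fun a ha x hx =>
    hfree.eq_one (Finset.mem_union_left _ ha) hx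
  have hsep : IsSeparated Q M := fun a ha b hb c hc d hd x hx hx' =>
    hMs _ (hDR _ (hQD a ha b hb) _ (hQD c hc d hd)) x hx hx'
  obtain ⟨r, hr, hrC⟩ := exists_isLocallyConstant_choice (fun (τ : Q) (x : X) => τ.1 • x ∉ C)
    (fun τ => hCl.smul_left τ.1) (fun x => by
      obtain ⟨τ, hτ⟩ := Finset.card_pos.1 (show 0 < (Q.filter fun τ => τ • x ∉ C).card from
        by have := hfilter x; omega)
      exact ⟨⟨τ, (Finset.mem_filter.1 hτ).1⟩, (Finset.mem_filter.1 hτ).2⟩)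
  set s : X → Finset G := slots Q C fun x => (r x).1 with hs
  have hsl : IsLocallyConstant s := by
    have := isLocallyConstant_filter (IsLocallyConstant.const (X := X) Q)
      (P := fun τ x => τ • x ∉ C ∧ τ ≠ (r x).1)
      (fun τ => (hCl.smul_left τ).comp₂ hr fun a b => a ∧ τ ≠ b.1)
    exact this
  have hsQ : ∀ x, s x ⊆ Q := fun x => Finset.filter_subset _ _
  have hscard : ∀ x, 4 * N + 1 ≤ (s x).card := by
    intro x
    have h1 : (Q.filter fun τ => τ • x ∉ C) ⊆ insert (r x).1 (s x) := by
      intro τ hτ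
      by_cases h : τ = (r x).1
      · exact Finset.mem_insert.2 (Or.inl h)
      · exact Finset.mem_insert_of_mem (mem_slots.2
          ⟨(Finset.mem_filter.1 hτ).1, (Finset.mem_filter.1 hτ).2, h⟩)
    have := (hfilter x).trans ((Finset.card_le_card h1).trans (Finset.card_insert_le _ _))
    omega
  -- On `W`, which contains `C` and everything outside the `Q`-neighbourhoods of markers, painting
  -- leaves `f` unchanged.
  let W : X → Prop := fun x => ¬ (x ∉ C ∧ ∃ τ ∈ Q, M (τ⁻¹ • x))
  have hW : IsLocallyConstant W := by
    refine isLocallyConstant_of_eventually fun x => ?_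
    have h1 : ∀ᶠ y in 𝓝 x, ∀ τ ∈ Q, M (τ⁻¹ • y) = M (τ⁻¹ • x) :=
      (Filter.eventually_all_finset _).2 fun τ _ => (hM.smul_left τ⁻¹).eventually_eq x
    filter_upwards [h1, hCl.eventually_eq x] with y hy hCy
    simp only [W, hCy]
    exact propext (not_congr (and_congr_right fun _ => exists_congr fun τ =>
      and_congr_right fun hτ => by rw [hy τ hτ]))
  obtain ⟨c, hc, hcM⟩ := exists_isLocallyConstant_pattern hX z Q H D E N hNQ
    (fun h hh x hx => hfree.eq_one (Finset.mem_union_right _ hh) hx) h1H hHinv hDinv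
    (hcard.trans_le (Nat.pow_le_pow_left hk N)) rank M W hM hW f hf s hsl hsQ
  obtain ⟨f', hf', hfs, hff⟩ := exists_paint z hM hsep hf hc hsl hsQ
  have hfC : ∀ x, x ∈ C → f' x = f x := fun x hx => hff x fun τ _ _ hτ => by
    have := (mem_slots.1 hτ).2.1
    rw [smul_inv_smul] at this
    exact this hx
  have hfW : ∀ x, W x → f' x = f x := by
    intro x hx
    refine hff x fun τ hτ hτM hτs => hx ⟨?_, τ, hτ, hτM⟩
    have := (mem_slots.1 hτs).2.1
    rwa [smul_inv_smul] at this
  -- `Z` consists of the reserved points, the only ones left uncoloured. Points outside `C` that are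
  -- neither painted nor reserved enter the new domain with whatever value the total function `f`
  -- has there.
  let Z : X → Prop := fun x => ∃ τ ∈ Q, M (τ⁻¹ • x) ∧ (r (τ⁻¹ • x)).1 = τ
  have hZ : IsLocallyConstant Z := by
    refine isLocallyConstant_of_eventually fun x => ?_
    have h1 : ∀ᶠ y in 𝓝 x, ∀ τ ∈ Q, M (τ⁻¹ • y) = M (τ⁻¹ • x) ∧ r (τ⁻¹ • y) = r (τ⁻¹ • x) :=
      (Filter.eventually_all_finset _).2 fun τ _ =>
        ((hM.smul_left τ⁻¹).eventually_eq x).and ((hr.smul_left τ⁻¹).eventually_eq x)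
    filter_upwards [h1] with y hy
    exact propext (exists_congr fun τ => and_congr_right fun hτ => by
      rw [(hy τ hτ).1, (hy τ hτ).2])
  have hZC : ∀ x, Z x → x ∉ C := by
    rintro x ⟨τ, hτ, hτM, hτr⟩
    have := hrC (τ⁻¹ • x)
    rwa [hτr, smul_inv_smul] at this
  have hWZ : ∀ x, W x → ¬ Z x := fun x hx hZx => by
    obtain ⟨τ, hτ, hτM, -⟩ := id hZx
    exact hx ⟨hZC x hZx, τ, hτ, hτM⟩
  have hsZ : ∀ x, M x → ∀ τ ∈ s x, ¬ Z (τ • x) := by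
    rintro x hx τ hτ ⟨τ', hτ', hM', hr'⟩
    obtain ⟨rfl, h2⟩ := hsep.eq_of_smul_eq (hsQ x hτ) hτ' hx hM' (by simp)
    rw [← h2] at hr'
    exact (mem_slots.1 hτ).2.2 hr'.symm
  refine ⟨{x | ¬ Z x}, f', hZ.setOf_isClopen.compl, hf', fun x hx hZx => hZC x hZx hx, hfC,
    fun x => ?_, fun _ x => ?_⟩
  · obtain ⟨a, ha, hax⟩ := hMc x
    refine ⟨(r (a • x)).1 * a, Finset.mem_image₂_of_mem (r (a • x)).2 ha, ?_⟩
    rw [Set.mem_ofPred_eq, not_not]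
    refine ⟨(r (a • x)).1, (r (a • x)).2, ?_, ?_⟩ <;> rw [mul_smul, inv_smul_smul]
    exact hax
  · obtain ⟨a, ha, hax⟩ := hMc x
    obtain ⟨h1, h2, h3⟩ := hcM _ hax
    obtain ⟨τ, hτ, hne, hor⟩ := exists_differing_slot hsep hQD hDE hEinv hrank hs hfs
      (fun x => Iff.rfl) hfW hax (hscard _) h1 h2 h3 (hRE a ha) (by simpa using hγ)
    -- Seen from the marker `a • x`, translation by `γ` becomes translation by the conjugate `a * γ
    -- * a⁻¹`, hence the role of `E`.
    have hγx : (τ * a * γ) • x = τ • (a * γ * a⁻¹) • a • x := by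
      simp only [smul_smul]; congr 1; group
    refine ⟨τ * a, Finset.mem_image₂_of_mem (hsQ _ hτ) ha, ?_, ?_, ?_⟩
    · rw [mul_smul]
      exact hsZ _ hax τ hτ
    · rw [hγx]
      rcases hor with hor | ⟨x', hx', τ', hτ', heq⟩
      · exact hWZ _ hor
      · rw [heq]
        exact hsZ _ hx' τ' hτ'
    · rwa [hγx, mul_smul τ a]

end Step
-- Extending continuous maps into discrete spaces
section Extension

theorem exists_isLocallyConstant_extension {X : Type*} [TopologicalSpace X] {C : Set X}
    (hC : IsClopen C) {A : Type*} [TopologicalSpace A] [DiscreteTopology A] (a₀ : A) {f : C → A}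
    (hf : Continuous f) :
    ∃ g : X → A, IsLocallyConstant g ∧ ∀ x : C, g x = f x := by
  classical
  have hfl : IsLocallyConstant f := (IsLocallyConstant.iff_continuous f).2 hf
  refine ⟨fun x => if h : x ∈ C then f ⟨x, h⟩ else a₀,
    isLocallyConstant_of_eventually fun x => ?_, fun x => by simp⟩
  by_cases hx : x ∈ C
  · have h1 := hfl.eventually_eq ⟨x, hx⟩
    rw [nhds_subtype_eq_comap, Filter.eventually_comap] at h1
    filter_upwards [h1, hC.isOpen.mem_nhds hx] with y hy hyC
    simp only [hx, hyC, dif_pos]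
    exact hy ⟨y, hyC⟩ rfl
  · filter_upwards [hC.compl.isOpen.mem_nhds hx] with y hy
    rw [dif_neg hx, dif_neg hy]

/-- A continuous map from a closed subset of a profinite space to a finite discrete space extends to
the whole space. -/
theorem exists_isLocallyConstant_extension_of_isClosed {X : Type*} [TopologicalSpace X]
    [CompactSpace X] [T2Space X] [TotallyDisconnectedSpace X] {Y : Set X} (hY : IsClosed Y)
    {A : Type*} [TopologicalSpace A] [DiscreteTopology A] [Finite A] [Nonempty A] {f : Y → A}
    (hf : Continuous f) :
    ∃ g : X → A, IsLocallyConstant g ∧ ∀ y : Y, g y = f y := by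
  have hcl : ∀ B : Set A, IsClosed ((↑) '' (f ⁻¹' B) : Set X) := fun B =>
    hY.isClosedEmbedding_subtypeVal.isClosedMap _ ((isClosed_discrete B).preimage hf)
  -- Each fibre of `f` is enclosed in a clopen set missing the other fibres. Points outside all
  -- these sets may later take any value.
  have hC : ∀ a : A, ∃ C : Set X, IsClopen C ∧ ((↑) '' (f ⁻¹' {a}) : Set X) ⊆ C ∧
      C ⊆ ((↑) '' (f ⁻¹' {a}ᶜ) : Set X)ᶜ := fun a =>
    exists_clopen_of_closed_subset_open (hcl _) (hcl _).isOpen_compl (by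
      rintro _ ⟨y, hy, rfl⟩ ⟨y', hy', h⟩
      rw [Subtype.ext h] at hy'
      exact hy' hy)
  choose C hC hC1 hC2 using hC
  obtain ⟨g, hg, hgP⟩ := exists_isLocallyConstant_choice
    (fun a x => x ∈ C a ∨ x ∉ ⋃ b, C b)
    (fun a => isLocallyConstant_of_isClopen
      ((hC a).union (isClopen_iUnion_of_finite hC).compl)) (fun x => by
      by_cases hx : x ∈ ⋃ b, C b
      · obtain ⟨b, hb⟩ := Set.mem_iUnion.1 hx
        exact ⟨b, Or.inl hb⟩
      · exact ⟨Classical.arbitrary A, Or.inr hx⟩)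
  refine ⟨g, hg, fun y => ?_⟩
  rcases hgP y with h | h
  · by_contra hne
    exact hC2 _ h ⟨y, fun h' => hne h'.symm, rfl⟩
  · exact absurd (Set.mem_iUnion.2 ⟨f y, hC1 _ ⟨y, rfl, rfl⟩⟩) h

end Extension

/-! ### Approximating free points by compactness -/

section Approximation

variable {G : Type*} [Group G] {k : ℕ}

theorem continuous_shift (γ : G) : Continuous (shift γ : (G → Fin k) → G → Fin k) :=
  continuous_pi fun δ => continuous_apply (δ * γ)

/-- The subshift of the points that are distinguished from their translates by `e i`, uniformly
within the windows `F i`, for all `i < n`. -/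
def distinguishing (k : ℕ) (e : ℕ → G) (F : ℕ → Finset G) (n : ℕ) : Subshift G k where
  carrier := {x | ∀ i < n, e i ≠ 1 → ∀ δ : G, ∃ σ ∈ F i, x (σ * δ) ≠ x (σ * e i * δ)}
  isClosed := by
    simp only [Set.ofPred_forall]
    refine isClosed_iInter fun i => isClosed_iInter fun _ => isClosed_iInter fun _ =>
      isClosed_iInter fun δ => ?_
    have : {x : G → Fin k | ∃ σ ∈ F i, x (σ * δ) ≠ x (σ * e i * δ)} =
        ⋃ σ ∈ F i, {x | x (σ * δ) ≠ x (σ * e i * δ)} := by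
      ext x; simp
    rw [this]
    refine (F i).finite_toSet.isClosed_biUnion fun σ _ => ?_
    have h : Continuous fun x : G → Fin k => (x (σ * δ), x (σ * e i * δ)) :=
      (continuous_apply _).prodMk (continuous_apply _)
    exact (isClosed_discrete {p : Fin k × Fin k | p.1 ≠ p.2}).preimage h
  shift_mem γ x hx i hi h δ := by
    obtain ⟨σ, hσ, hne⟩ := hx i hi h (δ * γ)
    exact ⟨σ, hσ, by simpa [shift, mul_assoc] using hne⟩

theorem distinguishing_anti (e : ℕ → G) (F : ℕ → Finset G) :
    Antitone fun n => (distinguishing k e F n).carrier :=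
  fun _ _ hmn _ hx i hi => hx i (hi.trans_le hmn)

theorem iInter_distinguishing_subset {e : ℕ → G} (he : Function.Surjective e)
    (F : ℕ → Finset G) : ⋂ n, (distinguishing k e F n).carrier ⊆ freePart G k := by
  intro x hx
  change stab x = {1}
  ext γ
  constructor
  · intro hγ
    by_contra hne
    obtain ⟨i, rfl⟩ := he γ
    obtain ⟨σ, -, h⟩ := Set.mem_iInter.1 hx (i + 1) i (Nat.lt_succ_self i) hne 1
    refine h ?_
    have := congrFun (show shift (e i) x = x from hγ) σ
    simpa [shift] using this.symm
  · rintro rfl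
    exact shift_one x

/-- Points satisfying sufficiently many of the constraints look, as far as `ρ` and a finite window
`D` are concerned, like free points. -/
theorem exists_approximation {m : ℕ} (hm : 1 ≤ m) {ρ : freePart G k → Fin m} (hρ : Continuous ρ)
    (D : Finset G) {e : ℕ → G} (he : Function.Surjective e) (F : ℕ → Finset G) :
    ∃ (n : ℕ) (ρ' : (distinguishing k e F n).carrier → Fin m), Continuous ρ' ∧
      ∀ z : (distinguishing k e F n).carrier, ∃ z' : freePart G k,
        (∀ δ ∈ D, z.1 δ = z'.1 δ) ∧
        ∀ δ ∈ D, ρ' ((distinguishing k e F n).act δ z) = ρ (freeShift δ z') := by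
  set Y : Set (G → Fin k) := ⋂ n, (distinguishing k e F n).carrier with hY
  have hYc : IsClosed Y := isClosed_iInter fun n => (distinguishing k e F n).isClosed
  have hYf : Y ⊆ freePart G k := iInter_distinguishing_subset he F
  have : Nonempty (Fin m) := ⟨⟨0, hm⟩⟩
  -- The free part need not be closed, so `ρ` is extended only from the closed subset `Y`.
  obtain ⟨ρ₁, hρ₁, hρY⟩ := exists_isLocallyConstant_extension_of_isClosed hYc
    (hρ.comp (continuous_inclusion hYf))
  let Ψ : (G → Fin k) → (D → Fin k) × (D → Fin m) :=
    fun x => (fun δ => x δ, fun δ => ρ₁ (shift δ x))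
  have hΨ : Continuous Ψ := (continuous_pi fun δ => continuous_apply _).prodMk
    (continuous_pi fun δ => hρ₁.continuous.comp (continuous_shift _))
  -- `Ψ` has discrete target, so the points sharing their `Ψ`-value with a point of `Y` form an open
  -- set around `Y`. It contains one of the decreasing closed sets.
  obtain ⟨n, hn⟩ := exists_subset_nhds_of_compactSpace
    (distinguishing_anti (k := k) e F).directed_ge (fun n => (distinguishing k e F n).isClosed)
    (U := Ψ ⁻¹' (Ψ '' Y)) fun x hx =>
      ((isOpen_discrete _).preimage hΨ).mem_nhds ⟨x, hx, rfl⟩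
  refine ⟨n, fun z => ρ₁ z, hρ₁.continuous.comp continuous_subtype_val, fun z => ?_⟩
  obtain ⟨y, hy, hyz⟩ := hn z.2
  refine ⟨⟨y, hYf hy⟩, fun δ hδ => ?_, fun δ hδ => ?_⟩
  · exact (congrFun (congrArg Prod.fst hyz) ⟨δ, hδ⟩).symm
  · have h1 : ρ₁ (shift δ y) = ρ₁ (shift δ z.1) := congrFun (congrArg Prod.snd hyz) ⟨δ, hδ⟩
    have h2 : shift δ y ∈ Y :=
      Set.mem_iInter.2 fun n => (distinguishing k e F n).shift_mem δ y (Set.mem_iInter.1 hy n)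
    exact h1.symm.trans (hρY ⟨_, h2⟩)

end Approximation

end BernoulliShift

/-! ### Assembling the steps -/

open BernoulliShift in
theorem mainTheorem6 (G : Type*) [Group G] [Countable G] [Infinite G]
    (k m : ℕ) (hk : 2 ≤ k) (hm : 1 ≤ m)
    (ρ : BernoulliShift.freePart G k → Fin m) (hρ : Continuous ρ) (D T : Finset G) :
    ∃ (Z : BernoulliShift.Subshift G k) (ρ' : Z.carrier → Fin m) (S : Finset G),
      Continuous ρ' ∧
      (∀ z : Z.carrier, ∃ z' : BernoulliShift.freePart G k,
        (∀ δ ∈ D, z.1 δ = z'.1 δ) ∧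
        (∀ δ ∈ D, ρ' (Z.act δ z) = ρ (BernoulliShift.freeShift δ z'))) ∧
      (∀ (X : Type*) [TopologicalSpace X] [PolishSpace X] [MulAction G X]
        [ContinuousConstSMul G X],
        BernoulliShift.IsZeroDimensional X → BernoulliShift.IsFreeOn S X →
        ∀ C₀ : Set X, IsClopen C₀ → BernoulliShift.IsSyndetic T C₀ᶜ →
        ∀ f₀ : C₀ → Fin k, Continuous f₀ →
        ∃ f : X → Fin k, Continuous f ∧ (∀ x : C₀, f x = f₀ x) ∧
          Set.range (BernoulliShift.codingMap (G := G) f) ⊆ Z.carrier) := by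
  classical
  obtain ⟨e, he⟩ := exists_surjective_nat G
  choose F T' S hstep using fun (γ : G) (T : Finset G) => exists_extension_step hk γ T
  -- The whole sequence of syndeticity sets and windows is fixed from group data before `n` is
  -- chosen by compactness and before `X` appears.
  let U : ℕ → Finset G := fun n => Nat.rec T (fun i A => T' (e i) A) n
  have hU : ∀ n, U (n + 1) = T' (e n) (U n) := fun n => rfl
  obtain ⟨n, ρ', hρ', hlike⟩ := exists_approximation hm hρ D he fun i => F (e i) (U i)
  refine ⟨distinguishing k e (fun i => F (e i) (U i)) n, ρ',
    (Finset.range n).biUnion fun i => S (e i) (U i), hρ', hlike, ?_⟩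
  intro X _ _ _ _ hX hfree C₀ hC₀ hsyn f₀ hf₀
  obtain ⟨g, hg, hgf⟩ := exists_isLocallyConstant_extension hC₀ (⟨0, by omega⟩ : Fin k) hf₀
  -- The witnesses are required to lie in `C`, where later steps preserve colours, so differences
  -- already achieved persist.
  have key : ∀ j ≤ n, ∃ (C : Set X) (f : X → Fin k), IsClopen C ∧ IsLocallyConstant f ∧ C₀ ⊆ C ∧
      (∀ x ∈ C₀, f x = g x) ∧ (∀ x : X, ∃ τ ∈ U j, τ • x ∉ C) ∧
      ∀ i < j, e i ≠ 1 → ∀ x : X, ∃ σ ∈ F (e i) (U i), σ • x ∈ C ∧ (σ * e i) • x ∈ C ∧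
        f (σ • x) ≠ f ((σ * e i) • x) := by
    intro j
    induction j with
    | zero =>
      exact fun _ => ⟨C₀, g, hC₀, hg, subset_rfl, fun _ _ => rfl, isSyndetic_iff.1 hsyn,
        fun i hi => absurd hi (Nat.not_lt_zero i)⟩
    | succ j ih =>
      intro hj
      obtain ⟨C, f, hC, hf, hsub, hfg, hUC, hdist⟩ := ih (by omega)
      have hfree' : IsFreeOn (S (e j) (U j)) X := fun x γ hγ =>
        hfree x ⟨Finset.mem_coe.2 (Finset.mem_biUnion.2 ⟨j, Finset.mem_range.2 hj, hγ.1⟩), hγ.2⟩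
      obtain ⟨C', f', hC', hf', hsub', hff, hUC', hdist'⟩ :=
        hstep (e j) (U j) X hX hfree' C f hC hf hUC
      refine ⟨C', f', hC', hf', hsub.trans hsub', fun x hx => (hff x (hsub hx)).trans (hfg x hx),
        hUC', fun i hi hne x => ?_⟩
      rcases Nat.lt_succ_iff_lt_or_eq.1 hi with hi | rfl
      · obtain ⟨σ, hσ, h1, h2, h3⟩ := hdist i hi hne x
        exact ⟨σ, hσ, hsub' h1, hsub' h2, by rwa [hff _ h1, hff _ h2]⟩
      · exact hdist' hne x
  obtain ⟨C, f, -, hf, -, hfg, -, hdist⟩ := key n le_rfl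
  refine ⟨f, hf.continuous, fun x => (hfg x x.2).trans (hgf x), ?_⟩
  rintro _ ⟨x, rfl⟩ i hi hne δ
  obtain ⟨σ, hσ, -, -, h⟩ := hdist i hi hne (δ • x)
  exact ⟨σ, hσ, by simpa [codingMap, mul_smul] using h⟩
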